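/- Let $k\ge 0$, $T\ge 1$, $\alpha>0$, $\boldsymbol\nu\in\mathbb R^k$, $\mathbf\Phi\in\mathbb R^{k\times k}$, let $\mathbf\Sigma(1),\dots,\mathbf\Sigma(T)$ be positive definite $k\times k$ matrices, and let $r_{f,1},\dots,r_{f,T}$ be deterministic riskless returns with $R_{f,t}=1+r_{f,t}\neq 0$. On a probability space with information sets (filtration) $\mathcal F_0\subseteq\dots\subseteq\mathcal F_T$, let the adapted return vectors $\mathbf X_0,\dots,\mathbf X_T$ of $k$ risky assets follow the Gaussian VAR(1) process $$\mathbf X_t=\boldsymbol\nu+\mathbf\Phi\mathbf X_{t-1}+\boldsymbol\varepsilon_t,\qquad \boldsymbol\varepsilon_t\sim\mathcal N(\mathbf 0,\mathbf\Sigma(t))\ \text{independent of }\mathcal F_{t-1},\qquad t=1,\dots,T,$$ so that $\mathbf X_t\mid\mathcal F_{t-1}\sim\mathcal N(\boldsymbol\nu+\mathbf\Phi\mathbf X_{t-1},\mathbf\Sigma(t))$. For portfolio weights $\mathbf w_0,\dots,\mathbf w_{T-1}$ with $\mathbf w_s$ $\mathcal F_s$-measurable, and $\mathcal F_0$-measurable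 initial wealth $W_0$, the wealth evolves as $$W_t=W_{t-1}\bigl(R_{f,t}+\mathbf w_{t-1}'(\mathbf X_t-r_{f,t}\mathbf 1)\bigr).$$ Put $\breve{\boldsymbol\nu}_t=\boldsymbol\nu-r_{f,t}\mathbf 1$ and $\breve{\boldsymbol\mu}_t=\breve{\boldsymbol\nu}_t+\mathbf\Phi\mathbf X_{t-1}$. Consider the problem of maximizing $E[-e^{-\alpha W_T}\mid\mathcal F_0]$ over all such $\mathbf w_0,\dots,\mathbf w_{T-1}$, where $W_0\ne0$ almost surely, and, more generally, for every $\tau\in\{0,\dots,T-1\}$ and all given weights before time $\tau$ for which $W_\tau\neq 0$ almost surely, the problem of maximizing $E[-e^{-\alpha W_T}\mid\mathcal F_\tau]$ over all such $\mathbf w_\tau,\dots,\mathbf w_{T-1}$. (The conditional expectations take values in $[-\infty,0]$; maximality is in the almost sure sense.) The maximum is attained, and $\mathbf w_\tau,\dots,\mathbf w_{T-1}$ attain it if and only if, almost surely, the wealth $W_\tau,\dots,W_{T-1}$ they generate is nonzero, $$\mathbf w_{T-1}=\frac{1}{\alpha W_{T-1}}\,\mathbf\Sigma^{-1}(T)\,\breve{\boldsymbol\mu}_T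 ,$$ and, for $t=2,\dots,T-\tau$, $$\mathbf w_{T-t}=\frac{1}{\alpha W_{T-t}\prod_{i=T-t+2}^{T}R_{f,i}}\Bigl(\mathbf\Sigma^{-1}(T-t+1)\,\breve{\boldsymbol\mu}_{T-t+1}-\mathbf\Phi'\,\mathbf\Sigma^{-1}(T-t+2)\bigl(\breve{\boldsymbol\nu}_{T-t+2}+r_{f,T-t+1}\mathbf\Phi\mathbf 1\bigr)\Bigr).$$ -/

import Mathlib

open MeasureTheory ProbabilityTheory Matrix

noncomputable section

namespace ExpPortfolio

variable {Ω : Type*} [mΩ : MeasurableSpace Ω] {k : ℕ}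

/-- The return vectors `X 0, …, X T` follow the Gaussian VAR(1) process
`X (t+1) = ν + Φ X t + ε (t+1)` relative to the information sets `ℱ t`: `X` is adapted, and the
innovation `ε (t+1)` is independent of `ℱ t` with law `N(0, S (t+1))`. Equivalently, the conditional
law of `X (t+1)` given `ℱ t` is `N(ν + Φ X t, S (t+1))`. The initial vector `X 0` is arbitrary. -/
structure IsGaussianVAR (P : Measure Ω) (ℱ : Filtration ℕ mΩ) (T : ℕ)
    (ν : Fin k → ℝ) (Φ : Matrix (Fin k) (Fin k) ℝ) (S : ℕ → Matrix (Fin k) (Fin k) ℝ)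
    (X ε : ℕ → Ω → Fin k → ℝ) : Prop where
  adapted : ∀ t ≤ T, Measurable[ℱ t] (X t)
  measurable_innovation : ∀ t < T, Measurable (ε (t + 1))
  recursion : ∀ t < T, ∀ᵐ ω ∂P, X (t + 1) ω = ν + Φ *ᵥ X t ω + ε (t + 1) ω
  law_innovation : ∀ t < T,
    HasLaw (fun ω => WithLp.toLp 2 (ε (t + 1) ω)) (multivariateGaussian 0 (S (t + 1))) P
  indep_innovation : ∀ t < T,
    Indep (MeasurableSpace.comap (ε (t + 1)) inferInstance) (ℱ t) P

/-- Wealth generated by the portfolio weights `w` from the initial wealth `W₀`: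
`W (t+1) = W t * (1 + r (t+1) + ⟨w t, X (t+1) - r (t+1) 1⟩)`. -/
def wealth (r : ℕ → ℝ) (X : ℕ → Ω → Fin k → ℝ) (W₀ : Ω → ℝ) (w : ℕ → Ω → Fin k → ℝ) :
    ℕ → Ω → ℝ
  | 0 => W₀
  | t + 1 => fun ω => wealth r X W₀ w t ω *
      (1 + r (t + 1) + w t ω ⬝ᵥ (X (t + 1) ω - r (t + 1) • (1 : Fin k → ℝ)))

/-- The weights chosen at each time before `T` use only the information available then. -/
def IsAdmissible (ℱ : Filtration ℕ mΩ) (T : ℕ) (w : ℕ → Ω → Fin k → ℝ) : Prop :=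
  ∀ s < T, Measurable[ℱ s] (w s)

/-- Exponential utility with absolute risk aversion `α`. -/
def utility (α x : ℝ) : ℝ := -Real.exp (-α * x)

/-- Conditional expected utility `E[U(W) | m]`, with values in `[-∞, 0]`. As `U < 0`, it is
minus the conditional expectation of the nonnegative variable `-U(W)`, which always exists in
`[0, ∞]`; no integrability is needed. -/
def condExpUtility (P : Measure Ω) (m : MeasurableSpace Ω) (α : ℝ) (W : Ω → ℝ) (ω : Ω) : EReal :=
  -((condLExp m P (fun ω' => ENNReal.ofReal (-utility α (W ω'))) ω : ENNReal) : EReal)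

/-- The admissible weights `w` attain the maximum of `E[U(W_T) | ℱ τ]` over the weights chosen at
the times `τ, …, T-1`, the weights used before `τ` (hence also the wealth at `τ`) being given. For
`τ = 0` this is the multi-period portfolio problem. -/
def IsOptimalFrom (P : Measure Ω) (ℱ : Filtration ℕ mΩ) (T : ℕ) (α : ℝ) (r : ℕ → ℝ)
    (X : ℕ → Ω → Fin k → ℝ) (W₀ : Ω → ℝ) (τ : ℕ) (w : ℕ → Ω → Fin k → ℝ) : Prop :=
  IsAdmissible ℱ T w ∧
    ∀ v : ℕ → Ω → Fin k → ℝ, IsAdmissible ℱ T v → (∀ s < τ, v s = w s) →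
      ∀ᵐ ω ∂P, condExpUtility P (ℱ τ) α (wealth r X W₀ v T) ω ≤
        condExpUtility P (ℱ τ) α (wealth r X W₀ w T) ω

/-- The excess intercept `ν - r t 1`. -/
def excessIntercept (ν : Fin k → ℝ) (r : ℕ → ℝ) (t : ℕ) : Fin k → ℝ :=
  ν - r t • (1 : Fin k → ℝ)

/-- The conditional mean `ν + Φ X (t-1) - r t 1` of the excess return `X t - r t 1`, for `1 ≤ t`. -/
def excessMean (ν : Fin k → ℝ) (Φ : Matrix (Fin k) (Fin k) ℝ) (r : ℕ → ℝ)
    (X : ℕ → Ω → Fin k → ℝ) (t : ℕ) (ω : Ω) : Fin k → ℝ :=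
  excessIntercept ν r t + Φ *ᵥ X (t - 1) ω

end ExpPortfolio

end

/-!
In terms of the amounts `W t • w t` invested in the risky assets the wealth is an additive process,
so the value function can be written down. At time `t`, with wealth `W` and return vector `x`, the
least expected value of `exp(-α W_T)` is

  `C t * exp(-α W ∏_{i > t} R i - m' S(t+1)⁻¹ m / 2)`,   `m = ν - r (t+1) 1 + Φ x`,

with a deterministic constant `C t` in `(0, ∞)` (`Model.minLoss`).

The Bellman equation reduces to one Gaussian integral. By the Cameron–Martin formula
(`lintegral_centeredGaussian_const_add`) the shift of the mean of the excess return becomes a linear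
term in the exponent; after completing the square, the amounts enter only through a vector `h` in an
integral `∫ exp(h'e + q e)` with `q` even (`lintegral_onePeriod`). Reflection turns the integrand
into `cosh(h'e) exp(q e)`, so the integral is least exactly at `h = 0`, because a nondegenerate
Gaussian law does not charge the hyperplane `h'e = 0`. The equation `h = 0` is the formula for the
optimal amounts (`Model.expLoss_eq_minLoss_iff`).

Along the wealth process of any admissible weights, the value function is therefore a submartingale
up to integrability, and it is a martingale from `τ` on exactly if the weights solve the one-period
problem almost surely at every time (`loss_eq_condLExp_iff`). As the value function at `τ` is
finite, although perhaps not integrable, this comparison is made on the sets where it is bounded.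
The amounts determine the weights where the wealth is nonzero; this holds almost surely for all
admissible weights (`wealth_ne_zero`), because the growth factor of a period is either the riskless
one or an affine function, without atoms, of a Gaussian vector.
-/

namespace ExpPortfolio

/-! ### Centred Gaussian vectors -/

section Gaussian

open scoped ENNReal MatrixOrder

variable {k : ℕ}

/-- The law `N(0, S)`, carried from `EuclideanSpace` to the function space `Fin k → ℝ` in which
the returns take their values. -/
noncomputable def centeredGaussian (S : Matrix (Fin k) (Fin k) ℝ) : Measure (Fin k → ℝ) :=
  (multivariateGaussian 0 S).map WithLp.ofLp

instance (S : Matrix (Fin k) (Fin k) ℝ) : IsProbabilityMeasure (centeredGaussian S) :=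
  Measure.isProbabilityMeasure_map (by fun_prop)

lemma gaussianReal_map_const_add_eq_withDensity (θ : ℝ) :
    (gaussianReal 0 1).map (θ + ·) =
      (gaussianReal 0 1).withDensity (fun x => ENNReal.ofReal (Real.exp (θ * x - θ * θ / 2))) := by
  rw [gaussianReal_map_const_add, gaussianReal_of_var_ne_zero _ one_ne_zero,
    gaussianReal_of_var_ne_zero _ one_ne_zero,
    ← withDensity_mul _ (measurable_gaussianPDF _ _) (by fun_prop)]
  congr 1
  ext x
  simp only [Pi.mul_apply, gaussianPDF, gaussianPDFReal]
  rw [← ENNReal.ofReal_mul (by positivity), mul_assoc (_⁻¹), ← Real.exp_add]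
  congr 3
  push_cast
  ring

lemma pi_gaussianReal_map_const_add (θ : Fin k → ℝ) :
    (Measure.pi fun _ : Fin k => gaussianReal 0 1).map (θ + ·) =
      (Measure.pi fun _ : Fin k => gaussianReal 0 1).withDensity
        (fun x => ENNReal.ofReal (Real.exp (θ ⬝ᵥ x - θ ⬝ᵥ θ / 2))) := by
  have h1 : (Measure.pi fun _ : Fin k => gaussianReal 0 1).map (θ + ·) =
      Measure.pi fun i : Fin k => (gaussianReal 0 1).map (θ i + ·) := by
    rw [← Measure.pi_map_pi (fun i => by fun_prop)]
    rfl
  rw [h1]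
  refine Measure.pi_eq fun s hs => ?_
  rw [withDensity_apply _ (MeasurableSet.univ_pi hs),
    ← lintegral_indicator (MeasurableSet.univ_pi hs)]
  set f : Fin k → ℝ → ℝ≥0∞ := fun i => (s i).indicator
    (fun x => ENNReal.ofReal (Real.exp (θ i * x - θ i * θ i / 2))) with hf
  have hfm : ∀ i, Measurable (f i) := fun i => Measurable.indicator (by fun_prop) (hs i)
  have h2 : ∀ x : Fin k → ℝ, (Set.univ.pi s).indicator
      (fun x => ENNReal.ofReal (Real.exp (θ ⬝ᵥ x - θ ⬝ᵥ θ / 2))) x = ∏ i, f i (x i) := by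
    intro x
    by_cases hx : x ∈ Set.univ.pi s
    · rw [Set.indicator_of_mem hx]
      have : ∀ i, f i (x i) = ENNReal.ofReal (Real.exp (θ i * x i - θ i * θ i / 2)) := fun i =>
        Set.indicator_of_mem (hx i trivial) _
      simp_rw [this]
      rw [← ENNReal.ofReal_prod_of_nonneg (fun i _ => (Real.exp_pos _).le), ← Real.exp_sum,
        Finset.sum_sub_distrib, ← Finset.sum_div]
      rfl
    · rw [Set.indicator_of_notMem hx]
      obtain ⟨i, hi⟩ : ∃ i, x i ∉ s i := by simpa [Set.mem_pi] using hx
      exact (Finset.prod_eq_zero (Finset.mem_univ i) (Set.indicator_of_notMem hi _)).symm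
  simp_rw [h2]
  refine (lintegral_prod_eq_prod_lintegral_of_indepFun Finset.univ
    (fun i (x : Fin k → ℝ) => f i (x i))
    (iIndepFun_pi fun i => (hfm i).aemeasurable)
    (fun i => (hfm i).comp (measurable_pi_apply i))).trans ?_
  refine Finset.prod_congr rfl fun i _ => ?_
  rw [gaussianReal_map_const_add_eq_withDensity, withDensity_apply _ (hs i),
    ← lintegral_indicator (hs i)]
  exact (measurePreserving_eval (fun _ : Fin k => gaussianReal 0 1) i).lintegral_comp (hfm i)

lemma exists_centeredGaussian_eq_map {S : Matrix (Fin k) (Fin k) ℝ} (hS : S.PosSemidef) :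
    ∃ A : Matrix (Fin k) (Fin k) ℝ, Aᵀ = A ∧ A * A = S ∧
      centeredGaussian S = (Measure.pi fun _ : Fin k => gaussianReal 0 1).map (A *ᵥ ·) := by
  refine ⟨CFC.sqrt S, ?_, CFC.sqrt_mul_sqrt_self _ hS.nonneg, ?_⟩
  · have := (CFC.sqrt_nonneg S).isSelfAdjoint
    simpa [IsSelfAdjoint, star_eq_conjTranspose] using this
  · rw [centeredGaussian, multivariateGaussian, ← map_pi_eq_stdGaussian,
      Measure.map_map (by fun_prop) (by fun_prop), Measure.map_map (by fun_prop) (by fun_prop)]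
    congr 1
    ext x i
    simp

/-- The Cameron–Martin formula in finite dimension: translating `N(0, S)` by `m` multiplies it by
the density `exp(m' S⁻¹ e - m' S⁻¹ m / 2)`. -/
lemma lintegral_centeredGaussian_const_add {S : Matrix (Fin k) (Fin k) ℝ} (hS : S.PosDef)
    (m : Fin k → ℝ) {f : (Fin k → ℝ) → ℝ≥0∞} (hf : Measurable f) :
    ∫⁻ e, f (m + e) ∂centeredGaussian S =
      ∫⁻ e, ENNReal.ofReal (Real.exp (m ⬝ᵥ (S⁻¹ *ᵥ e) - m ⬝ᵥ (S⁻¹ *ᵥ m) / 2)) * f e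
        ∂centeredGaussian S := by
  obtain ⟨A, hAt, hA, hG⟩ := exists_centeredGaussian_eq_map hS.posSemidef
  have hdet : IsUnit S.det := (Matrix.isUnit_iff_isUnit_det S).1 hS.isUnit
  have hSt : (S⁻¹)ᵀ = S⁻¹ := by rw [transpose_nonsing_inv, ← hA, transpose_mul, hAt]
  -- `θ` is the preimage of `m` under the square root `A` of `S`.
  set θ : Fin k → ℝ := A *ᵥ (S⁻¹ *ᵥ m) with hθ
  have hAθ : A *ᵥ θ = m := by
    rw [hθ, mulVec_mulVec, mulVec_mulVec, hA, mul_nonsing_inv _ hdet, one_mulVec]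
  have hdot : ∀ y, θ ⬝ᵥ y = m ⬝ᵥ (S⁻¹ *ᵥ (A *ᵥ y)) := by
    intro y
    rw [hθ, mulVec_mulVec, mulVec_mulVec, dotProduct_comm, dotProduct_mulVec,
      ← mulVec_transpose, transpose_mul, hAt, hSt, dotProduct_comm]
  have hAm : Measurable (fun x : Fin k → ℝ => A *ᵥ x) := by fun_prop
  have hden : Measurable fun x : Fin k → ℝ =>
    ENNReal.ofReal (Real.exp (θ ⬝ᵥ x - θ ⬝ᵥ θ / 2)) := by fun_prop
  rw [hG, lintegral_map (by fun_prop) hAm, lintegral_map (by fun_prop) hAm]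
  have h1 := lintegral_map (μ := Measure.pi fun _ : Fin k => gaussianReal 0 1)
    (f := fun y => f (A *ᵥ y)) (g := (θ + ·)) (by fun_prop) (by fun_prop)
  rw [pi_gaussianReal_map_const_add, lintegral_withDensity_eq_lintegral_mul _ hden (by fun_prop)]
    at h1
  simp only [mulVec_add, hAθ] at h1
  rw [← h1]
  refine lintegral_congr fun y => ?_
  simp only [Pi.mul_apply]
  rw [hdot y, hdot θ, hAθ]

lemma lintegral_centeredGaussian_neg {S : Matrix (Fin k) (Fin k) ℝ} (hS : S.PosSemidef)
    {f : (Fin k → ℝ) → ℝ≥0∞} (hf : Measurable f) :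
    ∫⁻ e, f (-e) ∂centeredGaussian S = ∫⁻ e, f e ∂centeredGaussian S := by
  obtain ⟨A, -, -, hG⟩ := exists_centeredGaussian_eq_map hS
  have h1 : (Measure.pi fun _ : Fin k => gaussianReal 0 1).map (fun x i => -x i) =
      Measure.pi fun _ : Fin k => gaussianReal 0 1 := by
    have : (gaussianReal 0 1).map (fun x => -x) = gaussianReal 0 1 := by
      rw [gaussianReal_map_neg, neg_zero]
    rw [Measure.pi_map_pi (f := fun _ x => -x) (fun i => by fun_prop)]
    simp_rw [this]
  rw [hG, lintegral_map (by fun_prop) (by fun_prop), lintegral_map (by fun_prop) (by fun_prop)]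
  conv_rhs => rw [← h1]
  rw [lintegral_map (by fun_prop) (by fun_prop)]
  refine lintegral_congr fun x => ?_
  rw [← mulVec_neg]
  rfl

/-- A nondegenerate Gaussian law does not charge hyperplanes. -/
lemma centeredGaussian_hyperplane {S : Matrix (Fin k) (Fin k) ℝ} (hS : S.PosDef)
    {h : Fin k → ℝ} (hh : h ≠ 0) (c : ℝ) : ∀ᵐ e ∂centeredGaussian S, h ⬝ᵥ e ≠ c := by
  set L : StrongDual ℝ (EuclideanSpace ℝ (Fin k)) := innerSL ℝ (WithLp.toLp 2 h) with hL
  have hLe : ∀ e, L e = h ⬝ᵥ WithLp.ofLp e := by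
    intro e
    simp [hL, EuclideanSpace.inner_eq_star_dotProduct, dotProduct_comm]
  have hvar : 0 < Var[L; multivariateGaussian 0 S] := by
    have h1 := covarianceBilin_multivariateGaussian (μ := 0) hS.posSemidef
      (WithLp.toLp 2 h) (WithLp.toLp 2 h)
    rw [covarianceBilin_self IsGaussian.memLp_two_id] at h1
    have h2 : (fun u => inner ℝ (WithLp.toLp 2 h) u) = L := rfl
    rw [h2] at h1
    rw [h1]
    simpa using hS.dotProduct_mulVec_pos hh
  have hnull : (multivariateGaussian 0 S).map L {c} = 0 := by
    rw [IsGaussian.map_eq_gaussianReal]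
    have := nullSingletonClass_gaussianReal (μ := ∫ x, L x ∂multivariateGaussian 0 S)
      (v := Var[L; multivariateGaussian 0 S].toNNReal) (by simpa using hvar)
    exact measure_singleton c
  rw [Measure.map_apply (by fun_prop) (measurableSet_singleton c)] at hnull
  simp only [ae_iff, not_not]
  rw [centeredGaussian, Measure.map_apply (by fun_prop)
    (measurableSet_eq_fun (by fun_prop) (by fun_prop))]
  convert hnull using 2
  ext e
  simp [hLe]

/-- Doubling a Gaussian integral by averaging it with its reflection: an exponential tilt turns into
a hyperbolic cosine. -/
lemma lintegral_exp_tilt_eq_cosh {S : Matrix (Fin k) (Fin k) ℝ} (hS : S.PosSemidef)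
    {q : (Fin k → ℝ) → ℝ} (hq : Measurable q) (heven : ∀ e, q (-e) = q e) (h : Fin k → ℝ) :
    2 * ∫⁻ e, ENNReal.ofReal (Real.exp (h ⬝ᵥ e + q e)) ∂centeredGaussian S =
      2 * ∫⁻ e, ENNReal.ofReal (Real.cosh (h ⬝ᵥ e) * Real.exp (q e)) ∂centeredGaussian S := by
  have hneg := lintegral_centeredGaussian_neg hS
    (f := fun e => ENNReal.ofReal (Real.exp (h ⬝ᵥ e + q e))) (by fun_prop)
  have hm : Measurable fun e : Fin k → ℝ =>
    ENNReal.ofReal (Real.cosh (h ⬝ᵥ e) * Real.exp (q e)) := by fun_prop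
  rw [← lintegral_const_mul _ hm, two_mul]
  nth_rw 1 [← hneg]
  rw [← lintegral_add_left (by fun_prop)]
  refine lintegral_congr fun e => ?_
  rw [← ENNReal.ofReal_add (Real.exp_pos _).le (Real.exp_pos _).le,
    show (2 : ℝ≥0∞) = ENNReal.ofReal 2 by simp, ← ENNReal.ofReal_mul zero_le_two, heven,
    dotProduct_neg, Real.exp_add, Real.exp_add, Real.cosh_eq]
  congr 1
  ring

lemma lintegral_exp_le_lintegral_exp_tilt {S : Matrix (Fin k) (Fin k) ℝ} (hS : S.PosSemidef)
    {q : (Fin k → ℝ) → ℝ} (hq : Measurable q) (heven : ∀ e, q (-e) = q e) (h : Fin k → ℝ) :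
    ∫⁻ e, ENNReal.ofReal (Real.exp (q e)) ∂centeredGaussian S ≤
      ∫⁻ e, ENNReal.ofReal (Real.exp (h ⬝ᵥ e + q e)) ∂centeredGaussian S := by
  have h1 := lintegral_exp_tilt_eq_cosh hS hq heven h
  rw [ENNReal.mul_right_inj two_ne_zero ENNReal.ofNat_ne_top] at h1
  rw [h1]
  refine lintegral_mono fun e => ENNReal.ofReal_le_ofReal ?_
  nlinarith [Real.one_le_cosh (h ⬝ᵥ e), Real.exp_pos (q e)]

/-- Strict convexity: the untilted integral is the smallest one, and only for zero tilt. -/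
lemma eq_zero_of_lintegral_exp_tilt_eq {S : Matrix (Fin k) (Fin k) ℝ} (hS : S.PosDef)
    {q : (Fin k → ℝ) → ℝ} (hq : Measurable q) (heven : ∀ e, q (-e) = q e)
    (hfin : ∫⁻ e, ENNReal.ofReal (Real.exp (q e)) ∂centeredGaussian S ≠ ∞) {h : Fin k → ℝ}
    (heq : ∫⁻ e, ENNReal.ofReal (Real.exp (h ⬝ᵥ e + q e)) ∂centeredGaussian S =
      ∫⁻ e, ENNReal.ofReal (Real.exp (q e)) ∂centeredGaussian S) : h = 0 := by
  by_contra hne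
  have h1 := lintegral_exp_tilt_eq_cosh hS.posSemidef hq heven h
  rw [ENNReal.mul_right_inj two_ne_zero ENNReal.ofNat_ne_top, heq] at h1
  have h2 := ae_eq_of_ae_le_of_lintegral_le (μ := centeredGaussian S)
    (f := fun e => ENNReal.ofReal (Real.exp (q e)))
    (g := fun e => ENNReal.ofReal (Real.cosh (h ⬝ᵥ e) * Real.exp (q e)))
    (Filter.Eventually.of_forall fun e => ENNReal.ofReal_le_ofReal (by
      nlinarith [Real.one_le_cosh (h ⬝ᵥ e), Real.exp_pos (q e)]))
    hfin (by fun_prop) h1.symm.le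
  obtain ⟨e, he, he0⟩ := (h2.and (centeredGaussian_hyperplane hS hne 0)).exists
  have hc := Real.one_lt_cosh.2 he0
  have he' := (ENNReal.ofReal_eq_ofReal_iff (Real.exp_pos _).le (by positivity)).1 he
  nlinarith [Real.exp_pos (q e)]

end Gaussian

/-! ### The one-period problem -/

section OnePeriod

open scoped ENNReal

variable {k : ℕ}

/-- The quadratic part of the one-period exponent, with precision matrix `M` for the next period. -/
noncomputable def quadExponent (Φ M : Matrix (Fin k) (Fin k) ℝ) (d e : Fin k → ℝ) : ℝ :=
  -((Φ *ᵥ e) ⬝ᵥ (M *ᵥ (Φ *ᵥ e))) / 2 - d ⬝ᵥ (M *ᵥ d) / 2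

/-- The deterministic factor contributed by one period of optimal investment. -/
noncomputable def periodConst (S Φ M : Matrix (Fin k) (Fin k) ℝ) (d : Fin k → ℝ) : ℝ≥0∞ :=
  ∫⁻ e, ENNReal.ofReal (Real.exp (quadExponent Φ M d e)) ∂centeredGaussian S

variable {S Φ M : Matrix (Fin k) (Fin k) ℝ}

@[fun_prop]
lemma measurable_quadExponent (d : Fin k → ℝ) : Measurable (quadExponent Φ M d) := by
  unfold quadExponent
  fun_prop

lemma quadExponent_neg (d e : Fin k → ℝ) : quadExponent Φ M d (-e) = quadExponent Φ M d e := by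
  simp [quadExponent, mulVec_neg]

lemma periodConst_ne_zero (d : Fin k → ℝ) : periodConst S Φ M d ≠ 0 := by
  intro h
  rw [periodConst, lintegral_eq_zero_iff (by fun_prop)] at h
  obtain ⟨e, he⟩ := h.exists
  exact (ENNReal.ofReal_pos.2 (Real.exp_pos _)).ne' he

lemma periodConst_ne_top (hM : M.PosSemidef) (d : Fin k → ℝ) : periodConst S Φ M d ≠ ∞ := by
  refine ne_top_of_le_ne_top ENNReal.one_ne_top ?_
  calc periodConst S Φ M d ≤ ∫⁻ _, 1 ∂centeredGaussian S := by
        refine lintegral_mono fun e => ?_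
        rw [← ENNReal.ofReal_one]
        refine ENNReal.ofReal_le_ofReal (Real.exp_le_one_iff.2 ?_)
        have h1 := hM.dotProduct_mulVec_nonneg (Φ *ᵥ e)
        have h2 := hM.dotProduct_mulVec_nonneg d
        simp only [star_trivial] at h1 h2
        rw [quadExponent]
        linarith
    _ = 1 := by simp

/-- Completing the square, through the Cameron–Martin formula: the cost of the position `b` depends
on `b` only through the tilt `S⁻¹ m - Φ' M d - b`. -/
lemma lintegral_onePeriod (hS : S.PosDef) (hM : M.PosSemidef) (b m d : Fin k → ℝ) :
    ∫⁻ e, ENNReal.ofReal (Real.exp (-(b ⬝ᵥ (m + e)) -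
        (d + Φ *ᵥ (m + e)) ⬝ᵥ (M *ᵥ (d + Φ *ᵥ (m + e))) / 2)) ∂centeredGaussian S =
      ENNReal.ofReal (Real.exp (-(m ⬝ᵥ (S⁻¹ *ᵥ m)) / 2)) *
        ∫⁻ e, ENNReal.ofReal (Real.exp ((S⁻¹ *ᵥ m - Φᵀ *ᵥ (M *ᵥ d) - b) ⬝ᵥ e +
          quadExponent Φ M d e)) ∂centeredGaussian S := by
  have hMt : Mᵀ = M := by simpa [IsHermitian] using hM.isHermitian
  have hSt : (S⁻¹)ᵀ = S⁻¹ := by simpa [IsHermitian] using hS.inv.isHermitian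
  rw [lintegral_centeredGaussian_const_add hS m (f := fun z => ENNReal.ofReal (Real.exp
      (-(b ⬝ᵥ z) - (d + Φ *ᵥ z) ⬝ᵥ (M *ᵥ (d + Φ *ᵥ z)) / 2))) (by fun_prop),
    ← lintegral_const_mul _ (by fun_prop)]
  refine lintegral_congr fun e => ?_
  rw [← ENNReal.ofReal_mul (Real.exp_pos _).le, ← ENNReal.ofReal_mul (Real.exp_pos _).le,
    ← Real.exp_add, ← Real.exp_add]
  congr 2
  have h1 : m ⬝ᵥ (S⁻¹ *ᵥ e) = (S⁻¹ *ᵥ m) ⬝ᵥ e := by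
    rw [dotProduct_mulVec, ← mulVec_transpose, hSt]
  have h2 : (Φᵀ *ᵥ (M *ᵥ d)) ⬝ᵥ e = (Φ *ᵥ e) ⬝ᵥ (M *ᵥ d) := by
    rw [mulVec_transpose, ← dotProduct_mulVec, dotProduct_comm]
  have h3 : d ⬝ᵥ (M *ᵥ (Φ *ᵥ e)) = (Φ *ᵥ e) ⬝ᵥ (M *ᵥ d) := by
    rw [dotProduct_mulVec, ← mulVec_transpose, hMt, dotProduct_comm]
  simp only [mulVec_add, dotProduct_add, add_dotProduct, sub_dotProduct, quadExponent, h1, h2, h3]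
  ring

lemma le_lintegral_onePeriod (hS : S.PosDef) (hM : M.PosSemidef) (b m d : Fin k → ℝ) :
    ENNReal.ofReal (Real.exp (-(m ⬝ᵥ (S⁻¹ *ᵥ m)) / 2)) * periodConst S Φ M d ≤
      ∫⁻ e, ENNReal.ofReal (Real.exp (-(b ⬝ᵥ (m + e)) -
        (d + Φ *ᵥ (m + e)) ⬝ᵥ (M *ᵥ (d + Φ *ᵥ (m + e))) / 2)) ∂centeredGaussian S := by
  rw [lintegral_onePeriod hS hM]
  gcongr
  exact lintegral_exp_le_lintegral_exp_tilt hS.posSemidef (by fun_prop) (quadExponent_neg d) _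

lemma lintegral_onePeriod_eq_iff (hS : S.PosDef) (hM : M.PosSemidef) (b m d : Fin k → ℝ) :
    ∫⁻ e, ENNReal.ofReal (Real.exp (-(b ⬝ᵥ (m + e)) -
        (d + Φ *ᵥ (m + e)) ⬝ᵥ (M *ᵥ (d + Φ *ᵥ (m + e))) / 2)) ∂centeredGaussian S =
      ENNReal.ofReal (Real.exp (-(m ⬝ᵥ (S⁻¹ *ᵥ m)) / 2)) * periodConst S Φ M d ↔
    b = S⁻¹ *ᵥ m - Φᵀ *ᵥ (M *ᵥ d) := by
  rw [lintegral_onePeriod hS hM, ENNReal.mul_right_inj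
    (ENNReal.ofReal_pos.2 (Real.exp_pos _)).ne' ENNReal.ofReal_ne_top]
  constructor
  · intro h
    exact (sub_eq_zero.1 (eq_zero_of_lintegral_exp_tilt_eq hS (by fun_prop) (quadExponent_neg d)
      (periodConst_ne_top hM d) h)).symm
  · rintro rfl
    simp [periodConst]

end OnePeriod

/-! ### Integrating out an independent innovation -/

section Independence

open scoped ENNReal

variable {Ω : Type*} {m : MeasurableSpace Ω} [mΩ : MeasurableSpace Ω] {P : Measure Ω}
  [IsProbabilityMeasure P] {β γ : Type*} [MeasurableSpace β] [MeasurableSpace γ]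

lemma lintegral_comp_of_indep (hm : m ≤ mΩ) {ε : Ω → γ} (hε : Measurable ε)
    (hind : Indep (MeasurableSpace.comap ε inferInstance) m P) {Y : Ω → β} (hY : Measurable[m] Y)
    {f : β × γ → ℝ≥0∞} (hf : Measurable f) :
    ∫⁻ ω, f (Y ω, ε ω) ∂P = ∫⁻ ω, ∫⁻ e, f (Y ω, e) ∂(P.map ε) ∂P := by
  have hY' : Measurable Y := hY.mono hm le_rfl
  have hindY : IndepFun Y ε P := by
    rw [IndepFun_iff_Indep]
    exact indep_of_indep_of_le_left hind.symm (measurable_iff_comap_le.1 hY)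
  have hmap := (indepFun_iff_map_prod_eq_prod_map_map hY'.aemeasurable hε.aemeasurable).1 hindY
  have := Measure.isProbabilityMeasure_map (μ := P) hε.aemeasurable
  rw [← lintegral_map (μ := P) (g := fun ω => (Y ω, ε ω)) hf (hY'.prodMk hε), hmap,
    lintegral_prod _ hf.aemeasurable, lintegral_map hf.lintegral_prod_right' hY']

lemma setLIntegral_comp_of_indep (hm : m ≤ mΩ) {ε : Ω → γ} (hε : Measurable ε)
    (hind : Indep (MeasurableSpace.comap ε inferInstance) m P) {Y : Ω → β} (hY : Measurable[m] Y)
    {f : β × γ → ℝ≥0∞} (hf : Measurable f) {A : Set Ω} (hA : MeasurableSet[m] A) :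
    ∫⁻ ω in A, f (Y ω, ε ω) ∂P = ∫⁻ ω in A, ∫⁻ e, f (Y ω, e) ∂(P.map ε) ∂P := by
  set i : Ω → ℝ≥0∞ := A.indicator 1 with hi
  have him : Measurable[m] i := by
    rw [hi]
    exact (@measurable_const _ _ _ m (1 : ℝ≥0∞)).indicator hA
  have h := lintegral_comp_of_indep (f := fun z : (ℝ≥0∞ × β) × γ => z.1.1 * f (z.1.2, z.2))
    hm hε hind (him.prodMk hY) (by fun_prop)
  rw [← lintegral_indicator (hm _ hA), ← lintegral_indicator (hm _ hA)]
  convert h using 2 with ω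
  · ext ω
    by_cases hω : ω ∈ A <;> simp [hi, hω]
  · ext ω
    by_cases hω : ω ∈ A <;> simp [hi, hω]

lemma ae_le_condLExp (hm : m ≤ mΩ) {f g : Ω → ℝ≥0∞} (hf : Measurable[m] f)
    (h : ∀ A, MeasurableSet[m] A → ∫⁻ ω in A, f ω ∂P ≤ ∫⁻ ω in A, g ω ∂P) :
    ∀ᵐ ω ∂P, f ω ≤ condLExp m P g ω := by
  refine ae_le_of_ae_le_trim (hm := hm) ?_
  refine ae_le_of_forall_setLIntegral_le_of_sigmaFinite hf fun A hA _ => ?_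
  rw [setLIntegral_trim hm hf hA, setLIntegral_trim hm (measurable_condLExp m P g) hA,
    setLIntegral_condLExp hm P g hA]
  exact h A hA

end Independence

/-! ### The value function -/

/-- The deterministic data of the portfolio problem: horizon `T`, risk aversion `α`, VAR
coefficients `ν` and `Φ`, innovation covariances `S` and riskless returns `r`. -/
structure Model (k : ℕ) where
  /-- the horizon -/
  T : ℕ
  /-- the absolute risk aversion -/
  α : ℝ
  /-- the intercept of the returns -/
  ν : Fin k → ℝ
  /-- the autoregression matrix -/
  Φ : Matrix (Fin k) (Fin k) ℝ
  /-- the innovation covariances -/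
  S : ℕ → Matrix (Fin k) (Fin k) ℝ
  /-- the riskless returns -/
  r : ℕ → ℝ

namespace Model

open scoped ENNReal

variable {k : ℕ} (D : Model k)

/-- The riskless return `∏ (1 + r i)` accumulated over the periods `t + 1, …, T`. -/
noncomputable def gross (t : ℕ) : ℝ := ∏ i ∈ Finset.Icc (t + 1) D.T, (1 + D.r i)

/-- The inverse covariance `S t ⁻¹`, set to `0` after the horizon, so that the last period, in
which no future return has to be hedged, needs no separate treatment. -/
noncomputable def precision (t : ℕ) : Matrix (Fin k) (Fin k) ℝ := if t ≤ D.T then (D.S t)⁻¹ else 0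

/-- The conditional mean of the excess return at `t + 1`, given the return vector `x` at `t`. -/
noncomputable def meanExcess (t : ℕ) (x : Fin k → ℝ) : Fin k → ℝ :=
  excessIntercept D.ν D.r (t + 1) + D.Φ *ᵥ x

/-- The mean excess return at `t + 2` when the excess return at `t + 1` is zero. -/
noncomputable def hedgeIntercept (t : ℕ) : Fin k → ℝ :=
  excessIntercept D.ν D.r (t + 2) + D.r (t + 1) • (D.Φ *ᵥ (1 : Fin k → ℝ))

/-- The product of the deterministic factors of the periods `t + 1, …, T`. -/
noncomputable def lossConst (t : ℕ) : ℝ≥0∞ :=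
  ∏ j ∈ Finset.Ico t D.T,
    periodConst (D.S (j + 1)) D.Φ (D.precision (j + 2)) (D.hedgeIntercept j)

/-- The value function, with the sign changed: the least expected value of `exp(-α W_T)` given
wealth `W` and return vector `x` at time `t`. -/
noncomputable def minLoss (t : ℕ) (W : ℝ) (x : Fin k → ℝ) : ℝ≥0∞ :=
  D.lossConst t * ENNReal.ofReal (Real.exp (-(D.α * W * D.gross t) -
    D.meanExcess t x ⬝ᵥ (D.precision (t + 1) *ᵥ D.meanExcess t x) / 2))

/-- The optimal amounts invested at time `t`, multiplied by `α * gross (t + 1)`. -/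
noncomputable def target (t : ℕ) (x : Fin k → ℝ) : Fin k → ℝ :=
  (D.S (t + 1))⁻¹ *ᵥ D.meanExcess t x - D.Φᵀ *ᵥ (D.precision (t + 2) *ᵥ D.hedgeIntercept t)

/-- Wealth at `t + 1` from wealth `W` and weights `w` at time `t`, when the return vector moves from
`x` with innovation `e`. -/
noncomputable def nextWealth (t : ℕ) (W : ℝ) (w x e : Fin k → ℝ) : ℝ :=
  W * (1 + D.r (t + 1) + w ⬝ᵥ (D.ν + D.Φ *ᵥ x + e - D.r (t + 1) • (1 : Fin k → ℝ)))

/-- The expected loss from the weights `w` at time `t` followed by optimal investment. -/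
noncomputable def expLoss (t : ℕ) (W : ℝ) (w x : Fin k → ℝ) : ℝ≥0∞ :=
  ∫⁻ e, D.minLoss (t + 1) (D.nextWealth t W w x e) (D.ν + D.Φ *ᵥ x + e)
    ∂centeredGaussian (D.S (t + 1))

variable {D}

lemma gross_eq_mul {t : ℕ} (ht : t < D.T) : D.gross t = (1 + D.r (t + 1)) * D.gross (t + 1) := by
  rw [gross, gross, ← Finset.insert_Icc_succ_left_eq_Icc (Nat.succ_le_of_lt ht),
    Finset.prod_insert (by simp)]
  rfl

lemma gross_ne_zero (hr : ∀ t, 1 ≤ t → t ≤ D.T → 1 + D.r t ≠ 0) (t : ℕ) : D.gross t ≠ 0 :=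
  Finset.prod_ne_zero_iff.2 fun i hi => by
    rw [Finset.mem_Icc] at hi
    exact hr i (by lia) hi.2

lemma precision_of_lt {t : ℕ} (ht : t < D.T) : D.precision (t + 1) = (D.S (t + 1))⁻¹ :=
  if_pos ht

lemma posSemidef_precision (hS : ∀ t, 1 ≤ t → t ≤ D.T → (D.S t).PosDef) (t : ℕ) :
    (D.precision (t + 1)).PosSemidef := by
  unfold precision
  split_ifs with h
  · exact (hS _ (by lia) h).inv.posSemidef
  · exact PosSemidef.zero

lemma lossConst_ne_zero (t : ℕ) : D.lossConst t ≠ 0 :=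
  Finset.prod_ne_zero_iff.2 fun _ _ => periodConst_ne_zero _

lemma lossConst_ne_top (hS : ∀ t, 1 ≤ t → t ≤ D.T → (D.S t).PosDef) (t : ℕ) :
    D.lossConst t ≠ ∞ :=
  ENNReal.prod_ne_top fun j _ => periodConst_ne_top (posSemidef_precision hS (j + 1)) _

lemma minLoss_ne_top (hS : ∀ t, 1 ≤ t → t ≤ D.T → (D.S t).PosDef) (t : ℕ) (W : ℝ)
    (x : Fin k → ℝ) : D.minLoss t W x ≠ ∞ :=
  ENNReal.mul_ne_top (lossConst_ne_top hS t) ENNReal.ofReal_ne_top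

lemma minLoss_horizon (W : ℝ) (x : Fin k → ℝ) :
    D.minLoss D.T W x = ENNReal.ofReal (Real.exp (-(D.α * W))) := by
  simp [minLoss, lossConst, gross, precision]

lemma measurable_minLoss (t : ℕ) :
    Measurable fun z : ℝ × (Fin k → ℝ) => D.minLoss t z.1 z.2 := by
  unfold minLoss meanExcess
  fun_prop

lemma measurable_nextWealth (t : ℕ) :
    Measurable fun z : (ℝ × (Fin k → ℝ) × (Fin k → ℝ)) × (Fin k → ℝ) =>
      D.nextWealth t z.1.1 z.1.2.1 z.1.2.2 z.2 := by
  unfold nextWealth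
  fun_prop

lemma measurable_minLoss_nextWealth (t : ℕ) :
    Measurable fun z : (ℝ × (Fin k → ℝ) × (Fin k → ℝ)) × (Fin k → ℝ) =>
      D.minLoss (t + 1) (D.nextWealth t z.1.1 z.1.2.1 z.1.2.2 z.2)
        (D.ν + D.Φ *ᵥ z.1.2.2 + z.2) := by
  have h1 : Measurable fun z : (ℝ × (Fin k → ℝ) × (Fin k → ℝ)) × (Fin k → ℝ) =>
      D.ν + D.Φ *ᵥ z.1.2.2 + z.2 := by fun_prop
  have h2 := (measurable_minLoss (D := D) (t + 1)).comp
    ((measurable_nextWealth (D := D) t).prodMk h1)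
  exact h2

lemma measurable_expLoss (t : ℕ) :
    Measurable fun z : ℝ × (Fin k → ℝ) × (Fin k → ℝ) => D.expLoss t z.1 z.2.1 z.2.2 :=
  (measurable_minLoss_nextWealth t).lintegral_prod_right'

lemma measurable_target (t : ℕ) : Measurable (D.target t) := by
  unfold target meanExcess
  fun_prop

lemma expLoss_eq {t : ℕ} (ht : t < D.T) (W : ℝ) (w x : Fin k → ℝ) :
    D.expLoss t W w x =
      (D.lossConst (t + 1) * ENNReal.ofReal (Real.exp (-(D.α * W * D.gross t)))) *
        ∫⁻ e, ENNReal.ofReal (Real.exp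
          (-(((D.α * W * D.gross (t + 1)) • w) ⬝ᵥ (D.meanExcess t x + e)) -
          (D.hedgeIntercept t + D.Φ *ᵥ (D.meanExcess t x + e)) ⬝ᵥ (D.precision (t + 2) *ᵥ
            (D.hedgeIntercept t + D.Φ *ᵥ (D.meanExcess t x + e))) / 2))
        ∂centeredGaussian (D.S (t + 1)) := by
  rw [expLoss, ← lintegral_const_mul _ (by fun_prop)]
  refine lintegral_congr fun e => ?_
  rw [minLoss, mul_assoc (D.lossConst _), ← ENNReal.ofReal_mul (Real.exp_pos _).le,
    ← Real.exp_add]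
  have h1 : D.meanExcess (t + 1) (D.ν + D.Φ *ᵥ x + e) =
      D.hedgeIntercept t + D.Φ *ᵥ (D.meanExcess t x + e) := by
    simp only [meanExcess, hedgeIntercept, excessIntercept, mulVec_add, mulVec_sub, mulVec_smul]
    abel
  have h2 : D.ν + D.Φ *ᵥ x + e - D.r (t + 1) • (1 : Fin k → ℝ) = D.meanExcess t x + e := by
    simp only [meanExcess, excessIntercept]
    abel
  rw [h1, nextWealth, h2, gross_eq_mul ht, smul_dotProduct, smul_eq_mul]
  congr 3
  ring

lemma minLoss_eq {t : ℕ} (ht : t < D.T) (W : ℝ) (x : Fin k → ℝ) :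
    D.minLoss t W x =
      (D.lossConst (t + 1) * ENNReal.ofReal (Real.exp (-(D.α * W * D.gross t)))) *
        (ENNReal.ofReal (Real.exp (-(D.meanExcess t x ⬝ᵥ
            ((D.S (t + 1))⁻¹ *ᵥ D.meanExcess t x)) / 2)) *
          periodConst (D.S (t + 1)) D.Φ (D.precision (t + 2)) (D.hedgeIntercept t)) := by
  rw [minLoss, lossConst, Finset.prod_eq_prod_Ico_succ_bot ht, precision_of_lt ht, ← lossConst,
    sub_eq_add_neg, Real.exp_add, ENNReal.ofReal_mul (Real.exp_pos _).le, neg_div]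
  ring

lemma minLoss_le_expLoss (hS : ∀ t, 1 ≤ t → t ≤ D.T → (D.S t).PosDef) {t : ℕ} (ht : t < D.T)
    (W : ℝ) (w x : Fin k → ℝ) : D.minLoss t W x ≤ D.expLoss t W w x := by
  rw [expLoss_eq ht, minLoss_eq ht]
  gcongr
  exact le_lintegral_onePeriod (hS _ (by lia) ht) (posSemidef_precision hS (t + 1)) _ _ _

/-- The Bellman equation: the minimal loss is attained exactly at the amounts `W • w` which `target`
prescribes. -/
lemma expLoss_eq_minLoss_iff (hS : ∀ t, 1 ≤ t → t ≤ D.T → (D.S t).PosDef) {t : ℕ} (ht : t < D.T)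
    (W : ℝ) (w x : Fin k → ℝ) :
    D.expLoss t W w x = D.minLoss t W x ↔ (D.α * W * D.gross (t + 1)) • w = D.target t x := by
  rw [expLoss_eq ht, minLoss_eq ht, ENNReal.mul_right_inj
    (mul_ne_zero (lossConst_ne_zero _) (ENNReal.ofReal_pos.2 (Real.exp_pos _)).ne')
    (ENNReal.mul_ne_top (lossConst_ne_top hS _) ENNReal.ofReal_ne_top)]
  exact lintegral_onePeriod_eq_iff (hS _ (by lia) ht) (posSemidef_precision hS (t + 1)) _ _ _

end Model

/-! ### Investment along the return process -/

section Dynamic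

open scoped ENNReal

variable {Ω : Type*} [mΩ : MeasurableSpace Ω] {P : Measure Ω}
  {ℱ : Filtration ℕ mΩ} {k : ℕ} {D : Model k} {X ε : ℕ → Ω → Fin k → ℝ} {W₀ : Ω → ℝ}
  {v w : ℕ → Ω → Fin k → ℝ}

lemma IsGaussianVAR.map_innovation (hX : IsGaussianVAR P ℱ D.T D.ν D.Φ D.S X ε) {t : ℕ}
    (ht : t < D.T) : P.map (ε (t + 1)) = centeredGaussian (D.S (t + 1)) := by
  have h := hX.measurable_innovation t ht
  rw [centeredGaussian, ← (hX.law_innovation t ht).map_eq,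
    Measure.map_map (by fun_prop) (by fun_prop)]
  rfl

lemma measurable_wealth {r : ℕ → ℝ} {T : ℕ} (hXm : ∀ t ≤ T, Measurable[ℱ t] (X t))
    (hW₀ : Measurable[ℱ 0] W₀) (hv : IsAdmissible ℱ T v) :
    ∀ t ≤ T, Measurable[ℱ t] (wealth r X W₀ v t) := by
  intro t
  induction t with
  | zero => exact fun _ => hW₀
  | succ t ih =>
    intro ht
    have hle : ℱ t ≤ ℱ (t + 1) := ℱ.mono (Nat.le_succ t)
    have h1 := (ih (by lia)).mono hle le_rfl
    have h2 := (hv t (by lia)).mono hle le_rfl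
    have hg : Measurable fun z : ℝ × (Fin k → ℝ) × (Fin k → ℝ) =>
        z.1 * (1 + r (t + 1) + z.2.1 ⬝ᵥ (z.2.2 - r (t + 1) • (1 : Fin k → ℝ))) := by fun_prop
    exact hg.comp (h1.prodMk (h2.prodMk (hXm _ ht)))

omit mΩ in
lemma wealth_congr {r : ℕ → ℝ} {t : ℕ} (h : ∀ s < t, v s = w s) :
    wealth r X W₀ v t = wealth r X W₀ w t := by
  induction t with
  | zero => rfl
  | succ t ih =>
    ext ω
    simp only [wealth, ih fun s hs => h s (by lia), h t (by lia)]

/-- The minimal loss along the wealth process which the weights `v` generate. -/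
noncomputable def loss (D : Model k) (X : ℕ → Ω → Fin k → ℝ) (W₀ : Ω → ℝ)
    (v : ℕ → Ω → Fin k → ℝ) (t : ℕ) (ω : Ω) : ℝ≥0∞ :=
  D.minLoss t (wealth D.r X W₀ v t ω) (X t ω)

/-- The expected loss at time `t` along the wealth process, when only the weights of time `t` are
taken from `v` and all later ones are optimal. -/
noncomputable def stepLoss (D : Model k) (X : ℕ → Ω → Fin k → ℝ) (W₀ : Ω → ℝ)
    (v : ℕ → Ω → Fin k → ℝ) (t : ℕ) (ω : Ω) : ℝ≥0∞ :=
  D.expLoss t (wealth D.r X W₀ v t ω) (v t ω) (X t ω)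

variable (hS : ∀ t, 1 ≤ t → t ≤ D.T → (D.S t).PosDef)
  (hX : IsGaussianVAR P ℱ D.T D.ν D.Φ D.S X ε) (hW₀ : Measurable[ℱ 0] W₀)
  (hv : IsAdmissible ℱ D.T v)

include hX hW₀ hv

lemma measurable_loss {t : ℕ} (ht : t ≤ D.T) : Measurable[ℱ t] (loss D X W₀ v t) := by
  have h := (Model.measurable_minLoss (D := D) t).comp
    ((measurable_wealth (r := D.r) hX.adapted hW₀ hv t ht).prodMk (hX.adapted t ht))
  exact h

lemma measurable_state {t : ℕ} (ht : t < D.T) :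
    Measurable[ℱ t] fun ω => (wealth D.r X W₀ v t ω, v t ω, X t ω) :=
  (measurable_wealth hX.adapted hW₀ hv t ht.le).prodMk
    ((hv t ht).prodMk (hX.adapted t ht.le))

lemma measurable_stepLoss {t : ℕ} (ht : t < D.T) : Measurable[ℱ t] (stepLoss D X W₀ v t) := by
  have h := (Model.measurable_expLoss (D := D) t).comp (measurable_state hX hW₀ hv ht)
  exact h

variable [IsProbabilityMeasure P]

/-- `stepLoss` is the conditional expectation of the next `loss`. -/
lemma setLIntegral_loss_succ {t : ℕ} (ht : t < D.T) {A : Set Ω} (hA : MeasurableSet[ℱ t] A) :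
    ∫⁻ ω in A, loss D X W₀ v (t + 1) ω ∂P = ∫⁻ ω in A, stepLoss D X W₀ v t ω ∂P := by
  have h := setLIntegral_comp_of_indep (ℱ.le t) (hX.measurable_innovation t ht)
    (hX.indep_innovation t ht) (measurable_state hX hW₀ hv ht)
    (Model.measurable_minLoss_nextWealth (D := D) t) hA
  rw [hX.map_innovation ht] at h
  refine Eq.trans ?_ h
  refine setLIntegral_congr_fun_ae (ℱ.le t _ hA) ?_
  filter_upwards [hX.recursion t ht] with ω hω _
  simp only [loss, wealth, Model.nextWealth, hω]

include hS

lemma setLIntegral_loss_mono {s t : ℕ} (hst : s ≤ t) (ht : t ≤ D.T) {A : Set Ω}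
    (hA : MeasurableSet[ℱ s] A) :
    ∫⁻ ω in A, loss D X W₀ v s ω ∂P ≤ ∫⁻ ω in A, loss D X W₀ v t ω ∂P := by
  induction t, hst using Nat.le_induction with
  | base => exact le_rfl
  | succ t hst ih =>
    refine (ih (by lia)).trans ?_
    rw [setLIntegral_loss_succ hX hW₀ hv ht (ℱ.mono hst _ hA)]
    exact lintegral_mono fun ω => Model.minLoss_le_expLoss hS ht _ _ _

/-- No admissible weights have a conditional expected loss below the value function. -/
lemma loss_le_condLExp {τ : ℕ} (hτ : τ ≤ D.T) :
    ∀ᵐ ω ∂P, loss D X W₀ v τ ω ≤ condLExp (ℱ τ) P (loss D X W₀ v D.T) ω :=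
  ae_le_condLExp (ℱ.le τ) (measurable_loss hX hW₀ hv hτ) fun _ hA =>
    setLIntegral_loss_mono hS hX hW₀ hv hτ le_rfl hA

/-- The value function is the conditional expected loss exactly for the weights that solve the
one-period problem at all times. -/
lemma loss_eq_condLExp_iff {τ : ℕ} (hτ : τ ≤ D.T) :
    (∀ᵐ ω ∂P, loss D X W₀ v τ ω = condLExp (ℱ τ) P (loss D X W₀ v D.T) ω) ↔
      ∀ t, τ ≤ t → t < D.T → ∀ᵐ ω ∂P, stepLoss D X W₀ v t ω = loss D X W₀ v t ω := by
  constructor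
  · intro h t hτt ht
    -- On these sets all integrals are finite; the wealth at `τ` itself need not be integrable.
    set A : ℕ → Set Ω := fun n => {ω | loss D X W₀ v τ ω ≤ n} with hA
    have hAm : ∀ n, MeasurableSet[ℱ τ] (A n) := fun n =>
      measurable_loss hX hW₀ hv hτ measurableSet_Iic
    have hcover : ∀ ω, ∃ n, ω ∈ A n := fun ω => by
      obtain ⟨n, hn⟩ := ENNReal.exists_nat_gt
        (Model.minLoss_ne_top hS τ (wealth D.r X W₀ v τ ω) (X τ ω))
      exact ⟨n, hn.le⟩
    have hn : ∀ n, ∀ᵐ ω ∂P, ω ∈ A n → stepLoss D X W₀ v t ω = loss D X W₀ v t ω := by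
      intro n
      have hAn := hAm n
      have hAt := ℱ.mono hτt _ hAn
      have htop : ∫⁻ ω in A n, loss D X W₀ v D.T ω ∂P = ∫⁻ ω in A n, loss D X W₀ v τ ω ∂P := by
        rw [← setLIntegral_condLExp (ℱ.le τ) P _ hAn]
        refine setLIntegral_congr_fun_ae (ℱ.le τ _ hAn) ?_
        filter_upwards [h] with ω hω _ using hω.symm
      have hfin : ∫⁻ ω in A n, loss D X W₀ v τ ω ∂P ≠ ∞ := by
        refine ne_top_of_le_ne_top (b := (n : ℝ≥0∞)) (ENNReal.natCast_ne_top n) ?_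
        calc ∫⁻ ω in A n, loss D X W₀ v τ ω ∂P ≤ ∫⁻ _ in A n, (n : ℝ≥0∞) ∂P :=
              setLIntegral_mono' (ℱ.le τ _ hAn) fun ω hω => hω
          _ = n * P (A n) := setLIntegral_const _ _
          _ ≤ n * 1 := by gcongr; exact prob_le_one
          _ = n := mul_one _
      have hup : ∫⁻ ω in A n, stepLoss D X W₀ v t ω ∂P ≤ ∫⁻ ω in A n, loss D X W₀ v τ ω ∂P := by
        rw [← setLIntegral_loss_succ hX hW₀ hv ht hAt, ← htop]
        exact setLIntegral_loss_mono hS hX hW₀ hv ht le_rfl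
          (ℱ.mono (Nat.le_succ t) _ hAt)
      have hlow : ∫⁻ ω in A n, loss D X W₀ v τ ω ∂P ≤ ∫⁻ ω in A n, loss D X W₀ v t ω ∂P :=
        setLIntegral_loss_mono hS hX hW₀ hv hτt ht.le hAn
      have hstep : ∀ ω, loss D X W₀ v t ω ≤ stepLoss D X W₀ v t ω := fun ω =>
        Model.minLoss_le_expLoss hS ht _ _ _
      have heq := ae_eq_of_ae_le_of_lintegral_le (μ := P.restrict (A n))
        (Filter.Eventually.of_forall hstep)
        (ne_top_of_le_ne_top hfin ((lintegral_mono hstep).trans hup))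
        ((measurable_stepLoss hX hW₀ hv ht).mono (ℱ.le t) le_rfl).aemeasurable
        (hup.trans hlow)
      exact (ae_restrict_iff' (ℱ.le τ _ hAn)).1 (heq.mono fun ω hω => hω.symm)
    filter_upwards [ae_all_iff.2 hn] with ω hω
    obtain ⟨n, hn⟩ := hcover ω
    exact hω n hn
  · intro h
    refine ae_eq_condLExp (ℱ.le τ) P _ (measurable_loss hX hW₀ hv hτ) fun A hA => ?_
    have key : ∀ t, τ ≤ t → t ≤ D.T →
        ∫⁻ ω in A, loss D X W₀ v τ ω ∂P = ∫⁻ ω in A, loss D X W₀ v t ω ∂P := by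
      intro t hτt
      induction t, hτt using Nat.le_induction with
      | base => exact fun _ => rfl
      | succ t hτt ih =>
        intro ht
        rw [ih (by lia), setLIntegral_loss_succ hX hW₀ hv ht (ℱ.mono hτt _ hA)]
        refine setLIntegral_congr_fun_ae (ℱ.le τ _ hA) ?_
        filter_upwards [h t hτt ht] with ω hω _ using hω.symm
    exact key D.T hτ le_rfl

/-- Admissible weights keep the wealth nonzero, whatever they are: the growth factor is either
the riskless one or has a Gaussian law without atoms. -/
lemma wealth_ne_zero (hr : ∀ t, 1 ≤ t → t ≤ D.T → 1 + D.r t ≠ 0) {τ : ℕ}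
    (hWτ : ∀ᵐ ω ∂P, wealth D.r X W₀ v τ ω ≠ 0) {t : ℕ} (hτt : τ ≤ t) (ht : t ≤ D.T) :
    ∀ᵐ ω ∂P, wealth D.r X W₀ v t ω ≠ 0 := by
  induction t, hτt using Nat.le_induction with
  | base => exact hWτ
  | succ t hτt ih =>
    set B : Set ((ℝ × (Fin k → ℝ) × (Fin k → ℝ)) × (Fin k → ℝ)) :=
      {z | D.nextWealth t 1 z.1.2.1 z.1.2.2 z.2 = 0} with hB
    have hBm : MeasurableSet B := by
      refine measurableSet_eq_fun ?_ measurable_const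
      unfold Model.nextWealth
      fun_prop
    have h := lintegral_comp_of_indep (ℱ.le t) (hX.measurable_innovation t ht)
      (hX.indep_innovation t ht) (measurable_state hX hW₀ hv ht)
      (f := B.indicator fun _ => 1) (measurable_const.indicator hBm)
    have hzero : ∀ ω, ∫⁻ e, B.indicator (fun _ => 1) ((wealth D.r X W₀ v t ω, v t ω, X t ω), e)
        ∂(P.map (ε (t + 1))) = (0 : ℝ≥0∞) := by
      intro ω
      rw [hX.map_innovation ht]
      refine lintegral_eq_zero_of_ae_eq_zero ?_
      by_cases hvω : v t ω = 0
      · refine Filter.Eventually.of_forall fun e => Set.indicator_of_notMem ?_ _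
        simpa [hB, Model.nextWealth, hvω] using hr (t + 1) (by lia) ht
      · filter_upwards [centeredGaussian_hyperplane (hS (t + 1) (by lia) ht) hvω
          (-(1 + D.r (t + 1) + v t ω ⬝ᵥ
            (D.ν + D.Φ *ᵥ X t ω - D.r (t + 1) • (1 : Fin k → ℝ))))] with e he
        refine Set.indicator_of_notMem (fun hmem => he ?_) _
        simp only [hB, Set.mem_ofPred_eq, Model.nextWealth, one_mul, dotProduct_sub,
          dotProduct_add] at hmem ⊢
        linarith
    simp only [hzero, lintegral_zero] at h
    have hcomp : Measurable fun ω => B.indicator (fun _ => (1 : ℝ≥0∞))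
        ((wealth D.r X W₀ v t ω, v t ω, X t ω), ε (t + 1) ω) :=
      (measurable_const.indicator hBm).comp
        (((measurable_state hX hW₀ hv ht).mono (ℱ.le t) le_rfl).prodMk
          (hX.measurable_innovation t ht))
    rw [lintegral_eq_zero_iff hcomp] at h
    filter_upwards [h, ih (by lia), hX.recursion t ht] with ω hω hW hrec
    have hnB : ((wealth D.r X W₀ v t ω, v t ω, X t ω), ε (t + 1) ω) ∉ B := fun hmem => by
      rw [Set.indicator_of_mem hmem] at hω
      exact one_ne_zero hω
    simp only [wealth, hrec]
    exact mul_ne_zero hW (by simpa [hB, Model.nextWealth] using hnB)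

end Dynamic

/-! ### The optimal weights -/

section Optimal

open scoped ENNReal

variable {Ω : Type*} [mΩ : MeasurableSpace Ω] {P : Measure Ω} {ℱ : Filtration ℕ mΩ} {k : ℕ}
  {D : Model k} {X ε : ℕ → Ω → Fin k → ℝ} {W₀ : Ω → ℝ} {w u : ℕ → Ω → Fin k → ℝ}

omit mΩ in
lemma loss_horizon (v : ℕ → Ω → Fin k → ℝ) (ω : Ω) : loss D X W₀ v D.T ω =
    ENNReal.ofReal (-utility D.α (wealth D.r X W₀ v D.T ω)) := by
  rw [loss, Model.minLoss_horizon, utility, neg_neg, neg_mul]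

lemma condExpUtility_le_iff (v w : ℕ → Ω → Fin k → ℝ) (τ : ℕ) (ω : Ω) :
    condExpUtility P (ℱ τ) D.α (wealth D.r X W₀ v D.T) ω ≤
        condExpUtility P (ℱ τ) D.α (wealth D.r X W₀ w D.T) ω ↔
      condLExp (ℱ τ) P (loss D X W₀ w D.T) ω ≤ condLExp (ℱ τ) P (loss D X W₀ v D.T) ω := by
  simp only [condExpUtility, ← loss_horizon]
  rw [EReal.neg_le_neg_iff, EReal.coe_ennreal_le_coe_ennreal_iff]

/-- The weights in feedback form: `u` before `τ`, and from `τ` on the solution of the one-period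
problem at wealth `W`. At `W = 0`, which the wealth reaches with probability zero, division by zero
makes the weights zero. -/
noncomputable def feedback (D : Model k) (X : ℕ → Ω → Fin k → ℝ) (u : ℕ → Ω → Fin k → ℝ) (τ t : ℕ)
    (W : ℝ) (ω : Ω) : Fin k → ℝ :=
  if t < τ then u t ω else (1 / (D.α * W * D.gross (t + 1))) • D.target t (X t ω)

/-- The wealth under the weights in feedback form. -/
noncomputable def feedbackWealth (D : Model k) (X : ℕ → Ω → Fin k → ℝ) (W₀ : Ω → ℝ)
    (u : ℕ → Ω → Fin k → ℝ) (τ : ℕ) : ℕ → Ω → ℝ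
  | 0 => W₀
  | t + 1 => fun ω => feedbackWealth D X W₀ u τ t ω *
      (1 + D.r (t + 1) + feedback D X u τ t (feedbackWealth D X W₀ u τ t ω) ω ⬝ᵥ
        (X (t + 1) ω - D.r (t + 1) • (1 : Fin k → ℝ)))

/-- The optimal weights from `τ` on, after the given weights `u`. -/
noncomputable def optimalWeights (D : Model k) (X : ℕ → Ω → Fin k → ℝ) (W₀ : Ω → ℝ)
    (u : ℕ → Ω → Fin k → ℝ) (τ t : ℕ) (ω : Ω) : Fin k → ℝ :=
  feedback D X u τ t (feedbackWealth D X W₀ u τ t ω) ω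

omit mΩ in
lemma wealth_optimalWeights (τ t : ℕ) :
    wealth D.r X W₀ (optimalWeights D X W₀ u τ) t = feedbackWealth D X W₀ u τ t := by
  induction t with
  | zero => rfl
  | succ t ih =>
    ext ω
    rw [wealth, ih]
    rfl

omit mΩ in
lemma optimalWeights_of_lt {τ s : ℕ} (hs : s < τ) : optimalWeights D X W₀ u τ s = u s := by
  ext ω
  simp [optimalWeights, feedback, hs]

omit mΩ in
lemma optimalWeights_of_le {τ t : ℕ} (ht : τ ≤ t) (ω : Ω) :
    optimalWeights D X W₀ u τ t ω =
      (1 / (D.α * wealth D.r X W₀ (optimalWeights D X W₀ u τ) t ω * D.gross (t + 1))) •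
        D.target t (X t ω) := by
  rw [wealth_optimalWeights, optimalWeights, feedback, if_neg (by lia)]

lemma isAdmissible_optimalWeights (hXm : ∀ t ≤ D.T, Measurable[ℱ t] (X t))
    (hW₀ : Measurable[ℱ 0] W₀) (hu : IsAdmissible ℱ D.T u) (τ : ℕ) :
    IsAdmissible ℱ D.T (optimalWeights D X W₀ u τ) := by
  intro s
  induction s using Nat.strong_induction_on with
  | _ s ih =>
    intro hs
    by_cases hsτ : s < τ
    · rw [optimalWeights_of_lt hsτ]
      exact hu s hs
    · -- Only the weights before `s`, measurable by induction, enter the wealth at `s`.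
      have hW : Measurable[ℱ s] (wealth D.r X W₀ (optimalWeights D X W₀ u τ) s) :=
        measurable_wealth (T := s) (fun t ht => hXm t (by lia)) hW₀
          (fun t ht => ih t ht (by lia)) s le_rfl
      have hg : Measurable fun z : ℝ × (Fin k → ℝ) =>
          (1 / (D.α * z.1 * D.gross (s + 1))) • D.target s z.2 := by
        have h1 : Measurable fun z : ℝ × (Fin k → ℝ) => D.target s z.2 :=
          (Model.measurable_target s).comp measurable_snd
        have h2 : Measurable fun z : ℝ × (Fin k → ℝ) => 1 / (D.α * z.1 * D.gross (s + 1)) := by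
          fun_prop
        exact h2.smul h1
      have h := hg.comp (hW.prodMk (hXm s hs.le))
      convert h using 1
      ext1 ω
      exact optimalWeights_of_le (by lia) ω

variable [IsProbabilityMeasure P] (hα : 0 < D.α) (hS : ∀ t, 1 ≤ t → t ≤ D.T → (D.S t).PosDef)
  (hr : ∀ t, 1 ≤ t → t ≤ D.T → 1 + D.r t ≠ 0)
  (hX : IsGaussianVAR P ℱ D.T D.ν D.Φ D.S X ε) (hW₀ : Measurable[ℱ 0] W₀)
  {τ : ℕ} (hτ : τ < D.T) (hu : IsAdmissible ℱ D.T u)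
  (hWτ : ∀ᵐ ω ∂P, wealth D.r X W₀ u τ ω ≠ 0)

include hα hS hr hX hW₀ hτ

/-- The one-period problems are solved almost surely exactly by weights given by the formula, the
wealth being nonzero. -/
lemma loss_eq_condLExp_iff_weights (hw : IsAdmissible ℱ D.T w)
    (hWτ : ∀ᵐ ω ∂P, wealth D.r X W₀ w τ ω ≠ 0) :
    (∀ᵐ ω ∂P, loss D X W₀ w τ ω = condLExp (ℱ τ) P (loss D X W₀ w D.T) ω) ↔
      ∀ᵐ ω ∂P, ∀ t, τ ≤ t → t < D.T → wealth D.r X W₀ w t ω ≠ 0 ∧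
        w t ω = (1 / (D.α * wealth D.r X W₀ w t ω * D.gross (t + 1))) • D.target t (X t ω) := by
  rw [loss_eq_condLExp_iff hS hX hW₀ hw hτ.le, ae_all_iff]
  refine forall_congr' fun t => ?_
  simp only [Filter.eventually_imp_distrib_left]
  refine forall_congr' fun hτt => forall_congr' fun ht => ?_
  refine Filter.eventually_congr ?_
  filter_upwards [wealth_ne_zero hS hX hW₀ hw hr hWτ hτt ht.le] with ω hω
  have hc : D.α * wealth D.r X W₀ w t ω * D.gross (t + 1) ≠ 0 :=
    mul_ne_zero (mul_ne_zero hα.ne' hω) (Model.gross_ne_zero hr _)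
  rw [stepLoss, loss, Model.expLoss_eq_minLoss_iff hS ht, one_div]
  constructor
  · intro h
    exact ⟨hω, by rw [← h, inv_smul_smul₀ hc]⟩
  · rintro ⟨-, h⟩
    rw [h, smul_inv_smul₀ hc]

include hu hWτ

lemma loss_optimalWeights :
    ∀ᵐ ω ∂P, loss D X W₀ (optimalWeights D X W₀ u τ) τ ω =
      condLExp (ℱ τ) P (loss D X W₀ (optimalWeights D X W₀ u τ) D.T) ω := by
  have hadm := isAdmissible_optimalWeights hX.adapted hW₀ hu τ
  have hW : ∀ᵐ ω ∂P, wealth D.r X W₀ (optimalWeights D X W₀ u τ) τ ω ≠ 0 := by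
    rwa [wealth_congr fun s hs => optimalWeights_of_lt hs]
  refine (loss_eq_condLExp_iff_weights hα hS hr hX hW₀ hτ hadm hW).2 ?_
  filter_upwards [ae_all_iff.2 fun t => Filter.eventually_imp_distrib_left.2 fun hτt =>
    Filter.eventually_imp_distrib_left.2 fun ht =>
      wealth_ne_zero hS hX hW₀ hadm hr hW (t := t) hτt ht] with ω hω t hτt ht
  exact ⟨hω t hτt ht.le, optimalWeights_of_le hτt ω⟩

/-- Weights are optimal from `τ` on exactly if their conditional expected loss is the value
function at `τ`. -/
lemma isOptimalFrom_iff (hw : IsAdmissible ℱ D.T w) (hwu : ∀ s < τ, w s = u s) :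
    IsOptimalFrom P ℱ D.T D.α D.r X W₀ τ w ↔
      ∀ᵐ ω ∂P, loss D X W₀ w τ ω = condLExp (ℱ τ) P (loss D X W₀ w D.T) ω := by
  -- The value function at `τ` depends only on the weights before `τ`.
  have hcongr : ∀ v : ℕ → Ω → Fin k → ℝ, (∀ s < τ, v s = w s) →
      loss D X W₀ v τ = loss D X W₀ w τ := fun v hv => by
    ext ω
    rw [loss, loss, wealth_congr hv]
  simp only [IsOptimalFrom, condExpUtility_le_iff]
  constructor
  · rintro ⟨-, h⟩
    have hopt : ∀ s < τ, optimalWeights D X W₀ u τ s = w s := fun s hs => by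
      rw [optimalWeights_of_lt hs, hwu s hs]
    filter_upwards [h _ (isAdmissible_optimalWeights hX.adapted hW₀ hu τ) hopt,
      loss_optimalWeights hα hS hr hX hW₀ hτ hu hWτ,
      loss_le_condLExp hS hX hW₀ hw hτ.le] with ω h1 h2 h3
    refine le_antisymm h3 (h1.trans ?_)
    rw [← h2, hcongr _ hopt]
  · intro h
    refine ⟨hw, fun v hv hvw => ?_⟩
    filter_upwards [h, loss_le_condLExp hS hX hW₀ hv hτ.le] with ω h1 h2
    rw [← h1, ← hcongr v hvw]
    exact h2

end Optimal

end ExpPortfolio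

theorem corollary1 {Ω : Type*} [mΩ : MeasurableSpace Ω] (P : Measure Ω) [IsProbabilityMeasure P]
    (ℱ : Filtration ℕ mΩ) {k : ℕ} (T : ℕ) (α : ℝ) (hα : 0 < α)
    (ν : Fin k → ℝ) (Φ : Matrix (Fin k) (Fin k) ℝ) (S : ℕ → Matrix (Fin k) (Fin k) ℝ)
    (hS : ∀ t, 1 ≤ t → t ≤ T → (S t).PosDef)
    (r : ℕ → ℝ) (hr : ∀ t, 1 ≤ t → t ≤ T → 1 + r t ≠ 0)
    (X ε : ℕ → Ω → Fin k → ℝ) (hX : ExpPortfolio.IsGaussianVAR P ℱ T ν Φ S X ε)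
    (W₀ : Ω → ℝ) (hW₀ : Measurable[ℱ 0] W₀)
    (τ : ℕ) (hτ : τ < T) (u : ℕ → Ω → Fin k → ℝ) (hu : ExpPortfolio.IsAdmissible ℱ T u)
    (hWτ : ∀ᵐ ω ∂P, ExpPortfolio.wealth r X W₀ u τ ω ≠ 0) :
    (∃ w : ℕ → Ω → Fin k → ℝ, (∀ s < τ, w s = u s) ∧
      ExpPortfolio.IsOptimalFrom P ℱ T α r X W₀ τ w) ∧
    ∀ w : ℕ → Ω → Fin k → ℝ, ExpPortfolio.IsAdmissible ℱ T w → (∀ s < τ, w s = u s) →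
      (ExpPortfolio.IsOptimalFrom P ℱ T α r X W₀ τ w ↔
        ∀ᵐ ω ∂P,
          (∀ t, 1 ≤ t → t ≤ T - τ → ExpPortfolio.wealth r X W₀ w (T - t) ω ≠ 0) ∧
          w (T - 1) ω = (1 / (α * ExpPortfolio.wealth r X W₀ w (T - 1) ω)) •
            ((S T)⁻¹ *ᵥ ExpPortfolio.excessMean ν Φ r X T ω) ∧
          ∀ t, 2 ≤ t → t ≤ T - τ →
            w (T - t) ω =
              (1 / (α * ExpPortfolio.wealth r X W₀ w (T - t) ω *
                ∏ i ∈ Finset.Icc (T - t + 2) T, (1 + r i))) •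
              ((S (T - t + 1))⁻¹ *ᵥ ExpPortfolio.excessMean ν Φ r X (T - t + 1) ω -
                Φᵀ *ᵥ ((S (T - t + 2))⁻¹ *ᵥ
                  (ExpPortfolio.excessIntercept ν r (T - t + 2) +
                    r (T - t + 1) • (Φ *ᵥ (1 : Fin k → ℝ)))))) := by

  set D : ExpPortfolio.Model k := ⟨T, α, ν, Φ, S, r⟩ with hD
  have hopt := ExpPortfolio.isAdmissible_optimalWeights (D := D) hX.adapted hW₀ hu τ
  have hlt : ∀ s < τ, ExpPortfolio.optimalWeights D X W₀ u τ s = u s := fun s hs =>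
    ExpPortfolio.optimalWeights_of_lt hs
  refine ⟨⟨ExpPortfolio.optimalWeights D X W₀ u τ, hlt,
    (ExpPortfolio.isOptimalFrom_iff (D := D) hα hS hr hX hW₀ hτ hu hWτ hopt hlt).2
      (ExpPortfolio.loss_optimalWeights (D := D) hα hS hr hX hW₀ hτ hu hWτ)⟩, fun w hw hwu => ?_⟩
  have hWw : ∀ᵐ ω ∂P, ExpPortfolio.wealth r X W₀ w τ ω ≠ 0 := by
    rwa [ExpPortfolio.wealth_congr hwu]
  refine (ExpPortfolio.isOptimalFrom_iff (D := D) hα hS hr hX hW₀ hτ hu hWτ hw hwu).trans ?_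
  refine (ExpPortfolio.loss_eq_condLExp_iff_weights (D := D) hα hS hr hX hW₀ hτ hw hWw).trans ?_
  refine Filter.eventually_congr (Filter.Eventually.of_forall fun ω => ?_)
  -- Time `s` here is `T - t` in the formulas; `s = T - 1` is the period without a hedging term.
  have hlast : ∀ s, s + 1 = T → D.gross (s + 1) = 1 ∧
      D.target s (X s ω) = (S T)⁻¹ *ᵥ ExpPortfolio.excessMean ν Φ r X T ω := by
    rintro s rfl
    simp [ExpPortfolio.Model.gross, ExpPortfolio.Model.target, ExpPortfolio.Model.precision,
      ExpPortfolio.Model.meanExcess, ExpPortfolio.excessMean, hD]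
  have hearlier : ∀ s, s + 2 ≤ T → D.target s (X s ω) =
      (S (s + 1))⁻¹ *ᵥ ExpPortfolio.excessMean ν Φ r X (s + 1) ω -
        Φᵀ *ᵥ ((S (s + 2))⁻¹ *ᵥ (ExpPortfolio.excessIntercept ν r (s + 2) +
          r (s + 1) • (Φ *ᵥ (1 : Fin k → ℝ)))) := by
    intro s hs
    rw [ExpPortfolio.Model.target, ExpPortfolio.Model.precision_of_lt (D := D) (t := s + 1) hs]
    rfl
  constructor
  · intro h
    refine ⟨fun t h1 ht => (h (T - t) (by lia) (by lia : T - t < T)).1, ?_, fun t h2 ht => ?_⟩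
    · obtain ⟨hg, htar⟩ := hlast (T - 1) (by lia)
      have := (h (T - 1) (by lia) (by lia : T - 1 < T)).2
      rwa [hg, htar, mul_one] at this
    · have := (h (T - t) (by lia) (by lia : T - t < T)).2
      rwa [hearlier (T - t) (by lia)] at this
  · rintro ⟨hne, hT, hbefore⟩ s hτs (hs : s < T)
    obtain ⟨t, ht, rfl⟩ : ∃ t, (1 ≤ t ∧ t ≤ T) ∧ s = T - t :=
      ⟨T - s, by lia, by lia⟩
    refine ⟨hne t ht.1 (by lia), ?_⟩
    rcases ht.1.eq_or_lt with rfl | h2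
    · obtain ⟨hg, htar⟩ := hlast (T - 1) (by lia)
      rw [hg, htar, mul_one]
      exact hT
    · rw [hearlier (T - t) (by lia)]
      exact hbefore t h2 (by lia)
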